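/- Let $\mathbb T$ be the unit circle with normalized Haar (Lebesgue) measure $m$, and let $H^\infty=\{f\in L^\infty(\mathbb T,m):\ \int_{\mathbb T}\overline\zeta^{\,k}f(\zeta)\,dm(\zeta)=0,\ k=-1,-2,\dots\}$, with the norm $\|\cdot\|_\infty$. For a finite set $\Phi$ of bounded linear functionals on $H^\infty$, put $H^\infty_\Phi=\{f\in H^\infty:\ \varphi(f)=0\text{ for all }\varphi\in\Phi\}$. For $f\in H^\infty_\Phi$ with $\|f\|_\infty=1$, a number $\varepsilon>0$ is called admissible for $f$ if there is a $\delta>0$ such that, for every $g\in H^\infty_\Phi$, the inequality $\max\{\|f+g\|_\infty,\|f-g\|_\infty\}<1+\delta$ implies $\|g\|_\infty<\varepsilon$; let $\varepsilon_\Phi(f)$ be the infimum of all $\varepsilon>0$ that are admissible for $f$. For a positive integer $N$ and numbers $0<\eta<1$, $0<\gamma<1$, let $$\varepsilon^*(N,\eta,\gamma)=\inf\bigl\{\varepsilon_\Phi(f):\ \Phi\subset(H^\infty)^*,\ \#\Phi=N,\ f\in H^\infty_\Phi,\ \|f\|_\infty=1,\ m(\{\zeta\in\mathbb T:|f(\zeta)|\le\eta\})\ge\gamma\bigr\}.$$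 Theorem. For every positive integer $N$ and all $\eta,\gamma\in(0,1)$, $$(c\gamma)^N(1-\eta)\le\varepsilon^*(N,\eta,\gamma)\le(1-\eta^2)^{1/2},$$ where $c>0$ is a numerical constant; one can take $c=\pi/(16e)$. -/

import Mathlib

open MeasureTheory
open scoped ENNReal

noncomputable section

namespace HardyExtreme

/-- `L^∞(𝕋, m)` with the essential supremum norm. The circle `𝕋` is `ℝ / ℤ`, with `t` standing for
the point `ζ = exp (2 π i t)`, and `m` is the Haar measure of total mass one. -/
abbrev LInf : Type := Lp ℂ ∞ (AddCircle.haarAddCircle : Measure UnitAddCircle)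

theorem integrable_fourier_smul (k : ℤ) (f : LInf) :
    Integrable (fun t : UnitAddCircle => fourier (-k) t • f t) AddCircle.haarAddCircle := by
  have hf : Integrable (f : UnitAddCircle → ℂ) AddCircle.haarAddCircle :=
    (Lp.memLp f).integrable (by simp)
  refine hf.bdd_smul (φ := fun t => fourier (-k) t) 1
    (fourier (-k)).continuous.aestronglyMeasurable (Filter.Eventually.of_forall fun t => ?_)
  rw [fourier_apply]
  exact (Circle.norm_coe _).le

/-- The Hardy space `H^∞`, as the subspace of those `f` in `L^∞` whose Fourier coefficients
`∫ conj(ζ)^k f(ζ) dm(ζ)` vanish for `k = -1, -2, …`. It carries the norm of `L^∞`. -/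
def HInf : Submodule ℂ LInf where
  carrier := {f | ∀ k : ℤ, k < 0 → fourierCoeff (f : UnitAddCircle → ℂ) k = 0}
  zero_mem' := by
    intro k _
    have h : ∀ᵐ t ∂(AddCircle.haarAddCircle : Measure UnitAddCircle),
        fourier (-k) t • ((0 : LInf) : UnitAddCircle → ℂ) t = 0 := by
      filter_upwards [Lp.coeFn_zero ℂ ∞ (AddCircle.haarAddCircle : Measure UnitAddCircle)]
        with t ht
      rw [ht, Pi.zero_apply, smul_zero]
    exact integral_eq_zero_of_ae h
  add_mem' := by
    intro f g hf hg k hk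
    have h : fourierCoeff ((f + g : LInf) : UnitAddCircle → ℂ) k =
        fourierCoeff (f : UnitAddCircle → ℂ) k + fourierCoeff (g : UnitAddCircle → ℂ) k := by
      unfold fourierCoeff
      rw [← integral_add (integrable_fourier_smul k f) (integrable_fourier_smul k g)]
      refine integral_congr_ae ?_
      filter_upwards [Lp.coeFn_add f g] with t ht
      rw [ht, Pi.add_apply, smul_add]
    rw [h, hf k hk, hg k hk, add_zero]
  smul_mem' := by
    intro c f hf k hk
    have h : fourierCoeff ((c • f : LInf) : UnitAddCircle → ℂ) k =
        c • fourierCoeff (f : UnitAddCircle → ℂ) k := by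
      unfold fourierCoeff
      rw [← integral_smul]
      refine integral_congr_ae ?_
      filter_upwards [Lp.coeFn_smul c f] with t ht
      simp only [ht, Pi.smul_apply, smul_eq_mul]
      ring
    rw [h, hf k hk, smul_zero]

/-- The subspace `H^∞_Φ` of `H^∞` annihilated by a set `Φ` of bounded linear functionals on `H^∞`. -/
def HInfPhi (Φ : Set (StrongDual ℂ HInf)) : Submodule ℂ HInf where
  carrier := {f | ∀ φ ∈ Φ, φ f = 0}
  zero_mem' := by intro φ _; exact map_zero φ
  add_mem' := by
    intro f g hf hg φ hφ
    rw [map_add, hf φ hφ, hg φ hφ, add_zero]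
  smul_mem' := by
    intro c f hf φ hφ
    rw [map_smul, hf φ hφ, smul_zero]

/-- `ε` is `X`-admissible for the point `x` of the normed space `X`: there is `δ > 0` such that
`max (‖x + y‖, ‖x - y‖) < 1 + δ` implies `‖y‖ < ε`, for all `y` in `X`. -/
def IsAdmissible {X : Type*} [NormedAddCommGroup X] (x : X) (ε : ℝ) : Prop :=
  0 < ε ∧ ∃ δ : ℝ, 0 < δ ∧ ∀ y : X, max ‖x + y‖ ‖x - y‖ < 1 + δ → ‖y‖ < ε

/-- The measure of non-strong-extremality `ε_Φ(f)`: the infimum of all numbers that are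
`H^∞_Φ`-admissible for `f`. -/
def epsPhi (Φ : Set (StrongDual ℂ HInf)) (f : HInfPhi Φ) : ℝ :=
  sInf {ε : ℝ | IsAdmissible f ε}

/-- The sublevel set `{ζ ∈ 𝕋 : |f(ζ)| ≤ η}` (defined up to a null set). -/
def sublevel (η : ℝ) (f : LInf) : Set UnitAddCircle := {t | ‖f t‖ ≤ η}

/-- The class of all unit-norm `f` in `H^∞_Φ` for which `m {|f| ≤ η} ≥ γ`. -/
def classM (Φ : Set (StrongDual ℂ HInf)) (η γ : ℝ) : Set (HInfPhi Φ) :=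
  {f | ‖f‖ = 1 ∧
    γ ≤ (AddCircle.haarAddCircle : Measure UnitAddCircle).real (sublevel η ((f : HInf) : LInf))}

/-- The set of all values `ε_Φ(f)`, where `Φ` has exactly `N` elements and `f` is in `classM Φ η γ`. -/
def epsValues (N : ℕ) (η γ : ℝ) : Set ℝ :=
  {e | ∃ Φ : Set (StrongDual ℂ HInf), Φ.encard = N ∧ ∃ f ∈ classM Φ η γ, e = epsPhi Φ f}

/-- The quantity `ε^*(N, η, γ)`: the infimum of `ε_Φ(f)` over all `Φ` with exactly `N` elements and
all `f` in `classM Φ η γ`. -/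
def epsStar (N : ℕ) (η γ : ℝ) : ℝ := sInf (epsValues N η γ)

end HardyExtreme

end

noncomputable section

namespace HardyExtreme

open Filter Topology Polynomial

/-! Lower bound: let E = {|f| ≤ η} and let G be an outer function with |G| = 1 - η on E and |G| = δ
off E (`exists_outer`). Then |f| + |G| ≤ 1 + δ a.e., so g = pG is a legitimate perturbation for
every polynomial p with |p| ≤ 1 on the circle. The polynomials of degree at most N form a space of
dimension N + 1, so some nonzero p puts pG in the common kernel of the N functionals; normalize max
|p| = 1. On E one has |g| = (1 - η)|p|, and since m(E) ≥ γ, p cannot be small on almost all of E: a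
Remez inequality (`remez`) gives ‖g‖ ≥ (γ/4)^N (1 - η). This is stronger than the stated bound,
because π/(16e) ≤ 1/4.

Upper bound: if |f| ≥ η a.e., the parallelogram law bounds |g|² by max ‖f ± g‖² - η² (`epsPhi_le`).
Such an f is ζG, with G outer of modulus η on an arc of measure γ and 1 elsewhere; it is annihilated
by N distinct multiples of the mean value functional (`exists_mem_classM`). -/

/-! ### Analytic functions on the circle -/

/-- The coordinate function `ζ` on the circle. -/
def coord (t : UnitAddCircle) : ℂ := AddCircle.toCircle t

@[fun_prop]
theorem continuous_coord : Continuous coord :=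
  continuous_subtype_val.comp AddCircle.continuous_toCircle

theorem norm_coord (t : UnitAddCircle) : ‖coord t‖ = 1 := Circle.norm_coe _

theorem coord_ne_zero (t : UnitAddCircle) : coord t ≠ 0 := Circle.coe_ne_zero _

theorem fourier_eq_coord_zpow (n : ℤ) (t : UnitAddCircle) : fourier n t = coord t ^ n := by
  rw [fourier_apply, AddCircle.toCircle_zsmul, coord, Circle.coe_zpow]

theorem fourier_natCast_eq_coord_pow (n : ℕ) (t : UnitAddCircle) :
    fourier (n : ℤ) t = coord t ^ n := by
  rw [fourier_eq_coord_zpow, zpow_natCast]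

theorem coord_coe (x : ℝ) :
    coord (x : UnitAddCircle) = Complex.exp ((2 * Real.pi * x : ℝ) * Complex.I) := by
  have := fourier_eq_coord_zpow 1 (x : UnitAddCircle)
  rw [zpow_one, fourier_coe_apply] at this
  rw [← this]
  push_cast
  ring_nf

/-- The mean value property of entire functions on the unit circle. -/
theorem integral_comp_coord {F : ℂ → ℂ} (hF : Differentiable ℂ F) :
    ∫ t, F (coord t) ∂(AddCircle.haarAddCircle : Measure UnitAddCircle) = F 0 := by
  have h1 := (hF.diffContOnCl (s := Metric.ball 0 |1|)).circleAverage
  rw [Real.circleAverage] at h1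
  rw [AddCircle.integral_haarAddCircle, ← AddCircle.intervalIntegral_preimage 1 0, ← h1]
  have h2 := intervalIntegral.integral_comp_mul_left (a := 0) (b := 1)
    (fun θ => F (circleMap 0 1 θ)) (c := 2 * Real.pi) (by positivity)
  rw [mul_zero, mul_one] at h2
  rw [← h2, inv_one, one_smul, zero_add]
  refine intervalIntegral.integral_congr fun x _ => ?_
  simp only [coord_coe, circleMap, zero_add, Complex.ofReal_one, one_mul]

/-- The coefficient of index -(n + 1) is the mean of z^(n+1) F(z), a function vanishing at 0. -/
theorem fourierCoeff_comp_coord {F : ℂ → ℂ} (hF : Differentiable ℂ F) {k : ℤ} (hk : k < 0) :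
    fourierCoeff (fun t : UnitAddCircle => F (coord t)) k = 0 := by
  obtain ⟨n, rfl⟩ : ∃ n : ℕ, k = -((n + 1 : ℕ) : ℤ) := ⟨(-k - 1).toNat, by push_cast; omega⟩
  have h := integral_comp_coord (F := fun z => z ^ (n + 1) * F z) (by fun_prop)
  rw [fourierCoeff]
  simp only [neg_neg, fourier_natCast_eq_coord_pow, smul_eq_mul]
  rw [h]
  simp

theorem continuous_eval_coord (q : ℂ[X]) : Continuous fun t => q.eval (coord t) :=
  q.continuous.comp continuous_coord

theorem integrable_of_continuous {E : Type*} [NormedAddCommGroup E] {f : UnitAddCircle → E}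
    (hf : Continuous f) : Integrable f (AddCircle.haarAddCircle : Measure UnitAddCircle) :=
  hf.integrable_of_hasCompactSupport (HasCompactSupport.of_compactSpace f)

theorem memLp_of_continuous {E : Type*} [NormedAddCommGroup E] {f : UnitAddCircle → E}
    (hf : Continuous f) (p : ℝ≥0∞) :
    MemLp f p (AddCircle.haarAddCircle : Measure UnitAddCircle) :=
  hf.memLp_of_hasCompactSupport (HasCompactSupport.of_compactSpace f)

/-! ### Outer functions of prescribed modulus -/

/-- The real part of the mean value identity for q² reads ∫ (Re q)² - ∫ (Im q)² = (Re q(0))² ≥ 0,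
because q(0) is real. Hence L² convergence of real parts forces that of the polynomials. -/
theorem integral_im_sq_le {q : ℂ[X]} (hq : (q.eval 0).im = 0) :
    ∫ t, (q.eval (coord t)).im ^ 2 ∂(AddCircle.haarAddCircle : Measure UnitAddCircle) ≤
      ∫ t, (q.eval (coord t)).re ^ 2 ∂(AddCircle.haarAddCircle : Measure UnitAddCircle) := by
  have hc := continuous_eval_coord q
  have h := integral_comp_coord (F := fun z => q.eval z ^ 2)
    (q.differentiable.pow 2)
  have h2 := congrArg Complex.re h
  have h3 : Integrable (fun t => q.eval (coord t) ^ 2)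
    (AddCircle.haarAddCircle : Measure UnitAddCircle) := integrable_of_continuous (hc.pow 2)
  have h4 := integral_re h3
  simp only [RCLike.re_to_complex] at h4
  rw [← h4] at h2
  simp only [pow_two, Complex.mul_re, hq, mul_zero, sub_zero] at h2
  rw [integral_sub (integrable_of_continuous (by fun_prop))
    (integrable_of_continuous (by fun_prop))] at h2
  simp only [pow_two]
  nlinarith [mul_self_nonneg (q.eval 0).re]

theorem eLpNorm_eval_coord_le {q : ℂ[X]} (hq : (q.eval 0).im = 0) :
    eLpNorm (fun t => q.eval (coord t)) 2 (AddCircle.haarAddCircle : Measure UnitAddCircle) ≤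
      2 * eLpNorm (fun t => (q.eval (coord t)).re) 2
        (AddCircle.haarAddCircle : Measure UnitAddCircle) := by
  have hc := continuous_eval_coord q
  have hre : Continuous fun t => (q.eval (coord t)).re := by fun_prop
  have him : Continuous fun t => (q.eval (coord t)).im := by fun_prop
  have h1 : eLpNorm (fun t => (q.eval (coord t)).im) 2
        (AddCircle.haarAddCircle : Measure UnitAddCircle) ≤
      eLpNorm (fun t => (q.eval (coord t)).re) 2
        (AddCircle.haarAddCircle : Measure UnitAddCircle) := by
    rw [(memLp_of_continuous hre 2).eLpNorm_eq_integral_rpow_norm (by simp) (by simp),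
      (memLp_of_continuous him 2).eLpNorm_eq_integral_rpow_norm (by simp) (by simp)]
    refine ENNReal.ofReal_le_ofReal (Real.rpow_le_rpow (by positivity) ?_ (by positivity))
    simpa using integral_im_sq_le hq
  have h2 : (fun t => q.eval (coord t)) =
      (fun t => ((q.eval (coord t)).re : ℂ)) + fun t => ((q.eval (coord t)).im : ℂ) * Complex.I := by
    ext t
    simp
  calc _ ≤ eLpNorm (fun t => ((q.eval (coord t)).re : ℂ)) 2 AddCircle.haarAddCircle +
        eLpNorm (fun t => ((q.eval (coord t)).im : ℂ) * Complex.I) 2 AddCircle.haarAddCircle := by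
        conv_lhs => rw [h2]
        exact eLpNorm_add_le (by fun_prop) (by fun_prop) (by norm_num)
    _ = eLpNorm (fun t => (q.eval (coord t)).re) 2 AddCircle.haarAddCircle +
        eLpNorm (fun t => (q.eval (coord t)).im) 2 AddCircle.haarAddCircle := by
        congr 1 <;> exact eLpNorm_congr_norm_ae (Eventually.of_forall fun t => by simp)
    _ ≤ _ := by
        rw [two_mul]
        gcongr

theorem exists_polynomial_re_eq {w : C(UnitAddCircle, ℂ)}
    (hw : w ∈ Submodule.span ℂ (Set.range (fourier (T := 1)))) :
    ∃ q : ℂ[X], ∀ t, (q.eval (coord t)).re = (w t).re := by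
  -- The factor c makes the claim stable under complex scalars, which taking real parts does not
  -- respect. Negative frequencies are replaced by their conjugates.
  have key : ∀ w ∈ Submodule.span ℂ (Set.range (fourier (T := 1))), ∀ c : ℂ,
      ∃ q : ℂ[X], ∀ t, (q.eval (coord t)).re = (c * w t).re := by
    intro w hw
    induction hw using Submodule.span_induction with
    | mem x hx =>
      obtain ⟨n, rfl⟩ := hx
      intro c
      obtain ⟨k, rfl | rfl⟩ := n.eq_nat_or_neg
      · exact ⟨C c * X ^ k, fun t => by rw [fourier_natCast_eq_coord_pow]; simp⟩
      · refine ⟨C (starRingEnd ℂ c) * X ^ k, fun t => ?_⟩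
        rw [fourier_neg, fourier_natCast_eq_coord_pow, ← Complex.conj_re]
        simp
    | zero => exact fun c => ⟨0, fun t => by simp⟩
    | add x y _ _ hx hy =>
      intro c
      obtain ⟨p, hp⟩ := hx c
      obtain ⟨q, hq⟩ := hy c
      exact ⟨p + q, fun t => by
        rw [eval_add, Complex.add_re, hp, hq, ContinuousMap.add_apply, mul_add, Complex.add_re]⟩
    | smul a x _ hx =>
      intro c
      obtain ⟨p, hp⟩ := hx (c * a)
      exact ⟨p, fun t => by rw [hp, ContinuousMap.smul_apply, smul_eq_mul, mul_assoc]⟩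
  obtain ⟨q, hq⟩ := key w hw 1
  exact ⟨q, fun t => by rw [hq, one_mul]⟩

theorem exists_polynomial_re_approx {v : UnitAddCircle → ℝ} (hv : Continuous v) {ε : ℝ}
    (hε : 0 < ε) :
    ∃ q : ℂ[X], (q.eval 0).im = 0 ∧ ∀ t, |(q.eval (coord t)).re - v t| < ε := by
  let V : C(UnitAddCircle, ℂ) := ⟨fun t => (v t : ℂ), by fun_prop⟩
  have hV : V ∈ (Submodule.span ℂ (Set.range (fourier (T := 1)))).topologicalClosure := by
    rw [span_fourier_closure_eq_top]; trivial
  obtain ⟨w, hw, hVw⟩ := Metric.mem_closure_iff.1 hV ε hε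
  obtain ⟨q, hq⟩ := exists_polynomial_re_eq hw
  refine ⟨q - C ((q.eval 0).im * Complex.I), by simp, fun t => ?_⟩
  have h1 : ‖V t - w t‖ < ε := by
    rw [← dist_eq_norm]
    exact (ContinuousMap.dist_apply_le_dist t).trans_lt hVw
  have h2 := (Complex.abs_re_le_norm (V t - w t)).trans_lt h1
  have h3 : (V t - w t).re = v t - (w t).re := by simp [V]
  rw [h3, abs_sub_comm] at h2
  simpa [hq] using h2

theorem toLp_mem_HInf {g : UnitAddCircle → ℂ}
    (hg : MemLp g ∞ (AddCircle.haarAddCircle : Measure UnitAddCircle))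
    (h : ∀ k : ℤ, k < 0 → fourierCoeff g k = 0) : hg.toLp g ∈ HInf := fun k hk => by
  rw [fourierCoeff_congr_ae hg.coeFn_toLp, h k hk]

/-- The upper bound C + 1 does not depend on ε; it later dominates the exponentials of the
approximants. -/
theorem exists_polynomial_re_approx_measurable {u : UnitAddCircle → ℝ} (hu : Measurable u) {C : ℝ}
    (hC : ∀ t, |u t| ≤ C) {ε : ℝ} (hε : 0 < ε) :
    ∃ q : ℂ[X], (q.eval 0).im = 0 ∧ (∀ t, (q.eval (coord t)).re ≤ C + 1) ∧
      eLpNorm (fun t => (q.eval (coord t)).re - u t) 2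
        (AddCircle.haarAddCircle : Measure UnitAddCircle) ≤ ENNReal.ofReal ε := by
  have hu2 : MemLp u 2 (AddCircle.haarAddCircle : Measure UnitAddCircle) :=
    MemLp.of_bound hu.aestronglyMeasurable C (Eventually.of_forall hC)
  obtain ⟨v, hv, -⟩ := hu2.exists_boundedContinuous_eLpNorm_sub_le (by simp)
    (ε := ENNReal.ofReal (ε / 2)) (by simpa using hε)
  have hC0 : 0 ≤ C := (abs_nonneg _).trans (hC 0)
  -- Clipping to [-C, C] is 1-Lipschitz and fixes u, so it does not increase the L² error.
  let w : UnitAddCircle → ℝ := fun t => max (-C) (min (v t) C)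
  have hw : Continuous w := by fun_prop
  obtain ⟨q, hq0, hq⟩ := exists_polynomial_re_approx hw (ε := min 1 (ε / 2)) (by positivity)
  refine ⟨q, hq0, fun t => ?_, ?_⟩
  · have h1 := (abs_lt.1 (hq t)).2
    have h2 : w t ≤ C := max_le (by linarith) (min_le_right _ _)
    linarith [min_le_left 1 (ε / 2)]
  · have h1 : (fun t => (q.eval (coord t)).re - u t) =
        (fun t => (q.eval (coord t)).re - w t) + fun t => w t - u t := by
      ext t; simp
    have hqc := continuous_eval_coord q
    have h2 : eLpNorm (fun t => (q.eval (coord t)).re - w t) 2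
        (AddCircle.haarAddCircle : Measure UnitAddCircle) ≤ ENNReal.ofReal (ε / 2) := by
      refine (eLpNorm_le_of_ae_bound (C := ε / 2) (Eventually.of_forall fun t => ?_)).trans ?_
      · exact (hq t).le.trans (min_le_right _ _)
      · simp
    have h3 : eLpNorm (fun t => w t - u t) 2
        (AddCircle.haarAddCircle : Measure UnitAddCircle) ≤ ENNReal.ofReal (ε / 2) := by
      refine (eLpNorm_mono fun t => ?_).trans hv
      have := abs_le.1 (hC t)
      rw [Pi.sub_apply, Real.norm_eq_abs, Real.norm_eq_abs, abs_sub_comm (u t)]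
      have h4 : u t = max (-C) (min (u t) C) := by
        rw [min_eq_left this.2, max_eq_right this.1]
      calc |w t - u t| = |max (-C) (min (v t) C) - max (-C) (min (u t) C)| := by rw [← h4]
        _ ≤ |min (v t) C - min (u t) C| := by
          simpa using abs_max_sub_max_le_max (-C) (min (v t) C) (-C) (min (u t) C)
        _ ≤ |v t - u t| := by
          simpa using abs_min_sub_min_le_max (v t) C (u t) C
    rw [h1]
    refine (eLpNorm_add_le (by fun_prop) (by fun_prop) (by norm_num)).trans ?_
    refine (add_le_add h2 h3).trans ?_
    rw [← ENNReal.ofReal_add (by positivity) (by positivity), add_halves]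

/-- For bounded measurable `u` there is a function in `H^∞` of modulus `exp u`. -/
theorem exists_outer {u : UnitAddCircle → ℝ} (hu : Measurable u) {C : ℝ} (hC : ∀ t, |u t| ≤ C) :
    ∃ G : LInf, G ∈ HInf ∧
      ∀ᵐ t ∂(AddCircle.haarAddCircle : Measure UnitAddCircle), ‖G t‖ = Real.exp (u t) := by
  -- The rate is geometric so that the q n converge a.e. without passing to a subsequence; the 8
  -- absorbs two triangle-inequality terms and the factor 2 of `eLpNorm_eval_coord_le`.
  choose q hq0 hqC hqu using fun n : ℕ => exists_polynomial_re_approx_measurable hu hC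
    (ε := (1 / 2) ^ n / 8) (by positivity)
  have hqc := fun n => continuous_eval_coord (q n)
  have hcau : ∀ N n m : ℕ, N ≤ n → N ≤ m →
      eLpNorm ((fun t => (q n).eval (coord t)) - fun t => (q m).eval (coord t)) 2
        (AddCircle.haarAddCircle : Measure UnitAddCircle) < ENNReal.ofReal ((1 / 2) ^ N) := by
    intro N n m hn hm
    have h1 : ((fun t => (q n).eval (coord t)) - fun t => (q m).eval (coord t)) =
        fun t => (q n - q m).eval (coord t) := by ext t; simp
    rw [h1]
    have h2 : ∀ k, N ≤ k → eLpNorm (fun t => ((q k).eval (coord t)).re - u t) 2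
        (AddCircle.haarAddCircle : Measure UnitAddCircle) ≤ ENNReal.ofReal ((1 / 2) ^ N / 8) :=
      fun k hk => (hqu k).trans (ENNReal.ofReal_le_ofReal (by
        gcongr ?_ / 8
        exact pow_le_pow_of_le_one (by norm_num) (by norm_num) hk))
    have h3 : eLpNorm (fun t => ((q n - q m).eval (coord t)).re) 2
        (AddCircle.haarAddCircle : Measure UnitAddCircle) ≤
        ENNReal.ofReal ((1 / 2) ^ N / 8) + ENNReal.ofReal ((1 / 2) ^ N / 8) := by
      have h4 : (fun t => ((q n - q m).eval (coord t)).re) =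
          (fun t => ((q n).eval (coord t)).re - u t) -
            fun t => ((q m).eval (coord t)).re - u t := by ext t; simp
      rw [h4]
      refine (eLpNorm_sub_le ?_ ?_ (by norm_num)).trans (add_le_add (h2 n hn) (h2 m hm))
      · have := hqc n
        exact (by fun_prop : Measurable _).aestronglyMeasurable
      · have := hqc m
        exact (by fun_prop : Measurable _).aestronglyMeasurable
    refine ((eLpNorm_eval_coord_le (by simp [hq0])).trans (mul_le_mul_right h3 2)).trans_lt ?_
    rw [← ENNReal.ofReal_add (by positivity) (by positivity), ← ENNReal.ofReal_ofNat,
      ← ENNReal.ofReal_mul (by norm_num), ENNReal.ofReal_lt_ofReal_iff (by positivity)]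
    have : (0 : ℝ) < (1 / 2) ^ N := by positivity
    linarith
  have hlim := Lp.ae_tendsto_of_cauchy_eLpNorm
    (fun n => (hqc n).aestronglyMeasurable) (by norm_num)
    (summable_geometric_two).tsum_ofReal_ne_top hcau
  obtain ⟨h, hhm, hh⟩ := exists_stronglyMeasurable_limit_of_tendsto_ae
    (fun n => (hqc n).aestronglyMeasurable) hlim
  have htm : TendstoInMeasure (AddCircle.haarAddCircle : Measure UnitAddCircle)
      (fun n t => ((q n).eval (coord t)).re) atTop u := by
    refine tendstoInMeasure_of_tendsto_eLpNorm (p := 2) (by simp) (fun n => ?_)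
      hu.aestronglyMeasurable ?_
    · have := hqc n
      fun_prop
    · have h0 : Tendsto (fun n : ℕ => ENNReal.ofReal ((1 / 2 : ℝ) ^ n / 8)) atTop (𝓝 0) := by
        rw [← ENNReal.ofReal_zero]
        refine ENNReal.tendsto_ofReal ?_
        simpa using (tendsto_pow_atTop_nhds_zero_of_lt_one (r := (1 / 2 : ℝ)) (by norm_num)
          (by norm_num)).div_const 8
      exact tendsto_of_tendsto_of_tendsto_of_le_of_le tendsto_const_nhds h0 (fun _ => zero_le)
        hqu
  obtain ⟨ns, hns, hre⟩ := htm.exists_seq_tendsto_ae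
  have hre' : ∀ᵐ t ∂(AddCircle.haarAddCircle : Measure UnitAddCircle), (h t).re = u t := by
    filter_upwards [hh, hre] with t h1 h2
    exact tendsto_nhds_unique
      (((Complex.continuous_re.tendsto _).comp h1).comp hns.tendsto_atTop) h2
  have hnorm : ∀ᵐ t ∂(AddCircle.haarAddCircle : Measure UnitAddCircle),
      ‖Complex.exp (h t)‖ = Real.exp (u t) := by
    filter_upwards [hre'] with t ht
    rw [Complex.norm_exp, ht]
  have hmem : MemLp (fun t => Complex.exp (h t)) ∞
      (AddCircle.haarAddCircle : Measure UnitAddCircle) := by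
    refine memLp_top_of_bound
      (Complex.continuous_exp.comp_stronglyMeasurable hhm).aestronglyMeasurable (Real.exp C) ?_
    filter_upwards [hnorm] with t ht
    rw [ht]
    exact Real.exp_le_exp.2 ((le_abs_self _).trans (hC t))
  refine ⟨hmem.toLp _, toLp_mem_HInf hmem fun k hk => ?_, ?_⟩
  · have hz : ∀ n, fourierCoeff (fun t => Complex.exp ((q n).eval (coord t))) k = 0 := fun n =>
      fourierCoeff_comp_coord (F := fun z => Complex.exp ((q n).eval z))
        (q n).differentiable.cexp hk
    -- The negative coefficients of exp(q n) vanish and pass to the limit by dominated convergence.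
    refine tendsto_nhds_unique (f := fun n => fourierCoeff
      (fun t => Complex.exp ((q n).eval (coord t))) k) (l := atTop) ?_ (by simp [hz])
    refine tendsto_integral_of_dominated_convergence (fun _ => Real.exp (C + 1)) (fun n => ?_)
      (integrable_const _) (fun n => Eventually.of_forall fun t => ?_) ?_
    · have := hqc n
      exact Continuous.aestronglyMeasurable (by fun_prop)
    · rw [norm_smul, fourier_apply, Circle.norm_coe, one_mul, Complex.norm_exp]
      exact Real.exp_le_exp.2 (hqC n t)
    · filter_upwards [hh] with t ht
      exact ((Complex.continuous_exp.tendsto _).comp ht).const_smul _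
  · filter_upwards [hmem.coeFn_toLp, hnorm] with t h1 h2
    rw [h1, h2]

/-! ### A Remez inequality on the circle -/

/-- The product is the modulus of the derivative of X^n - 1 at a root. -/
theorem prod_norm_sub_roots_of_unity {ω : ℂ} {n : ℕ} (hω : IsPrimitiveRoot ω n)
    (k : Fin n) : ∏ j ∈ Finset.univ.erase k, ‖ω ^ (k : ℕ) - ω ^ (j : ℕ)‖ = n := by
  have hn : 0 < n := k.pos
  have h1 : Lagrange.nodal Finset.univ (fun j : Fin n => ω ^ (j : ℕ)) = X ^ n - C 1 := by
    rw [X_pow_sub_C_eq_prod hω hn (one_pow n), Lagrange.nodal_eq,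
      Finset.prod_range]
    simp
  have h2 := Lagrange.eval_nodal_derivative_eval_node_eq
    (v := fun j : Fin n => ω ^ (j : ℕ)) (Finset.mem_univ k)
  rw [h1, Lagrange.eval_nodal] at h2
  rw [← norm_prod, ← h2]
  have : ‖ω‖ = 1 := hω.norm'_eq_one hn.ne'
  simp [derivative_X_pow, this]

theorem norm_coord_sub_coord (s : UnitAddCircle) (x y : ℝ) :
    ‖coord (s + (x : UnitAddCircle)) - coord (s + (y : UnitAddCircle))‖ =
      2 * |Real.sin (Real.pi * (x - y))| := by
  have hadd : ∀ a b : UnitAddCircle, coord (a + b) = coord a * coord b := fun a b => by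
    rw [coord, AddCircle.toCircle_add, Circle.coe_mul]; rfl
  have h1 : (x : UnitAddCircle) = ((x - y : ℝ) : UnitAddCircle) + (y : UnitAddCircle) := by
    rw [← AddCircle.coe_add, sub_add_cancel]
  rw [hadd, hadd, ← mul_sub, norm_mul, norm_coord, one_mul]
  conv_lhs => rw [h1, hadd]
  rw [← sub_one_mul, norm_mul, norm_coord, mul_one, coord_coe, mul_comm,
    Complex.norm_exp_I_mul_ofReal_sub_one, norm_mul, Real.norm_ofNat, Real.norm_eq_abs]
  congr 3
  ring

theorem mul_sin_le_sin_mul {c x : ℝ} (hc0 : 0 ≤ c) (hc1 : c ≤ 1) (hx0 : 0 ≤ x)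
    (hx1 : x ≤ Real.pi) : c * Real.sin x ≤ Real.sin (c * x) := by
  have h := strictConcaveOn_sin_Icc.concaveOn.2 ⟨hx0, hx1⟩
    ⟨le_rfl, Real.pi_pos.le⟩ hc0 (sub_nonneg.2 hc1) (by ring)
  simpa using h

/-- Comparison of the distances between points of a well separated subset of the `M`-th roots of
unity with the distances between `n`-th roots of unity. -/
theorem mul_sin_le_sin {n M d e : ℝ} (hn : 0 < n) (hnM : n ≤ M) (hd0 : 0 ≤ d) (hdn : d ≤ n)
    (hde : d ≤ e) (heM : e ≤ M - (n - d)) :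
    n / M * Real.sin (Real.pi * (d / n)) ≤ Real.sin (Real.pi * (e / M)) := by
  have hM : 0 < M := hn.trans_le hnM
  have hpi := Real.pi_pos
  have hc1 : n / M ≤ 1 := (div_le_one hM).2 hnM
  have key : ∀ r, 0 ≤ r → r ≤ n →
      n / M * Real.sin (Real.pi * (r / n)) ≤ Real.sin (Real.pi * (r / M)) := fun r h0 h1 => by
    have h2 : r / n ≤ 1 := (div_le_one hn).2 h1
    have := mul_sin_le_sin_mul (c := n / M) (x := Real.pi * (r / n)) (by positivity) hc1
      (by positivity) (by nlinarith)
    convert this using 2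
    field_simp
  have ha := key d hd0 hdn
  have hb := key (n - d) (by linarith) (by linarith)
  have hb1 : Real.sin (Real.pi * ((n - d) / n)) = Real.sin (Real.pi * (d / n)) := by
    rw [← Real.sin_pi_sub]
    congr 1
    field_simp
    ring
  have hb2 : Real.sin (Real.pi * ((n - d) / M)) = Real.sin (Real.pi * ((M - (n - d)) / M)) := by
    rw [← Real.sin_pi_sub]
    congr 1
    field_simp
  rw [hb1, hb2] at hb
  have mem : ∀ r, 0 ≤ r → r ≤ M → Real.pi * (r / M) ∈ Set.Icc 0 Real.pi := fun r h0 h1 => by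
    have h2 : r / M ≤ 1 := (div_le_one hM).2 h1
    exact ⟨by positivity, by nlinarith⟩
  -- A concave function on an interval is at least its minimum at the endpoints, here d and M - (n -
  -- d). Reflection x ↦ π - x turns the second endpoint into the case r = n - d.
  refine (le_min ha hb).trans (strictConcaveOn_sin_Icc.concaveOn.min_le_of_mem_Icc
    (mem d hd0 (hdn.trans hnM)) (mem _ (by linarith) (by linarith)) ⟨?_, ?_⟩)
  · gcongr
  · gcongr

theorem add_sub_le_of_strictMono {n : ℕ} {a : Fin n → ℕ} (ha : StrictMono a) :
    ∀ (d : ℕ) (i j : Fin n), (j : ℕ) = i + d → a i + d ≤ a j := by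
  intro d
  induction d with
  | zero => intro i j h; rw [Fin.ext (a := j) (b := i) (by simpa using h)]; simp
  | succ d ih =>
    intro i j h
    have h1 := ih i ⟨i + d, by omega⟩ rfl
    have h2 : a ⟨i + d, by omega⟩ < a j := ha (Fin.lt_def.2 (by simp; omega))
    omega

/-- Distinct integers leave gaps of at least 1, so the index gap along either of the two arcs
between the nodes is at least that between the (N+1)-th roots of unity; `mul_sin_le_sin` applies. -/
theorem norm_coord_sub_ge {N M : ℕ} {a : Fin (N + 1) → ℕ} (ha : StrictMono a)
    (haM : ∀ i, a i < M) (s : UnitAddCircle) (j k : Fin (N + 1)) :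
    ((N + 1 : ℕ) / M : ℝ) * ‖coord (0 + (((k : ℕ) / (N + 1 : ℕ) : ℝ) : UnitAddCircle)) -
        coord (0 + (((j : ℕ) / (N + 1 : ℕ) : ℝ) : UnitAddCircle))‖ ≤
      ‖coord (s + ((a k / M : ℝ) : UnitAddCircle)) -
        coord (s + ((a j / M : ℝ) : UnitAddCircle))‖ := by
  wlog hjk : j ≤ k generalizing j k
  · rw [norm_sub_rev, norm_sub_rev (coord (s + _))]
    exact this k j (le_of_not_ge hjk)
  have h1 := add_sub_le_of_strictMono ha (k - j) j k (by have := Fin.le_def.1 hjk; omega)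
  have h2 := add_sub_le_of_strictMono ha j 0 j (by simp)
  have h3 := add_sub_le_of_strictMono ha (N - k) k (Fin.last N) (by simp; omega)
  have h4 := haM (Fin.last N)
  have hjk' : (j : ℕ) ≤ k := hjk
  have hkN : (k : ℕ) ≤ N := by omega
  have h5 : a j + k ≤ a k + j := by omega
  have h6 : a k + (N + 1) ≤ M + k := by omega
  have h7 : N + 1 ≤ M := by omega
  have hjkr : ((j : ℕ) : ℝ) ≤ (k : ℕ) := by exact_mod_cast hjk'
  have hkNr : ((k : ℕ) : ℝ) ≤ N := by exact_mod_cast hkN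
  have h5r : (a j : ℝ) + (k : ℕ) ≤ a k + (j : ℕ) := by exact_mod_cast h5
  have h6r : (a k : ℝ) + (N + 1 : ℕ) ≤ M + (k : ℕ) := by exact_mod_cast h6
  have h7r : ((N + 1 : ℕ) : ℝ) ≤ M := by exact_mod_cast h7
  have h2r : ((j : ℕ) : ℝ) ≤ a j := by exact_mod_cast (by omega : (j : ℕ) ≤ a j)
  have h8r : (0 : ℝ) ≤ (j : ℕ) := by positivity
  have key := mul_sin_le_sin (n := (N + 1 : ℕ)) (M := M) (d := (k : ℕ) - (j : ℕ))
    (e := a k - a j) (by positivity) h7r (by linarith) (by push_cast; linarith) (by linarith)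
    (by linarith)
  rw [norm_coord_sub_coord, norm_coord_sub_coord, ← sub_div, ← sub_div]
  have hpos : 0 ≤ Real.sin (Real.pi * (((k : ℕ) - (j : ℕ) : ℝ) / (N + 1 : ℕ))) := by
    have h9 : ((k : ℕ) - (j : ℕ) : ℝ) / (N + 1 : ℕ) ≤ 1 := by
      rw [div_le_one (by positivity)]
      push_cast
      linarith
    refine Real.sin_nonneg_of_nonneg_of_le_pi ?_ ?_
    · have : 0 ≤ ((k : ℕ) - (j : ℕ) : ℝ) := by linarith
      positivity
    · nlinarith [Real.pi_pos]
  rw [abs_of_nonneg hpos]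
  nlinarith [le_abs_self (Real.sin (Real.pi * ((a k - a j : ℝ) / M)))]

/-- Lagrange interpolation at nodes among the rotated `M`-th roots of unity. -/
theorem norm_eval_le_of_nodes {N M : ℕ} {a : Fin (N + 1) → ℕ} (ha : StrictMono a)
    (haM : ∀ i, a i < M) (s : UnitAddCircle) {p : ℂ[X]} (hp : p.degree < (N + 1 : ℕ)) {K : ℝ}
    (hK : ∀ i, ‖p.eval (coord (s + ((a i / M : ℝ) : UnitAddCircle)))‖ ≤ K) {z : ℂ}
    (hz : ‖z‖ = 1) : ‖p.eval z‖ ≤ (2 * M / (N + 1 : ℕ) : ℝ) ^ N * K := by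
  let v : Fin (N + 1) → ℂ := fun i => coord (s + ((a i / M : ℝ) : UnitAddCircle))
  let ω : ℂ := Complex.exp (2 * Real.pi * Complex.I / (N + 1 : ℕ))
  have hω : IsPrimitiveRoot ω (N + 1) := Complex.isPrimitiveRoot_exp _ (by omega)
  have hωk : ∀ k : ℕ, ω ^ k = coord (0 + ((k / (N + 1 : ℕ) : ℝ) : UnitAddCircle)) := fun k => by
    rw [zero_add, coord_coe, ← Complex.exp_nat_mul]
    congr 1
    push_cast
    ring
  have hM : (0 : ℝ) < M := by exact_mod_cast (Nat.zero_le _).trans_lt (haM 0)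
  have hsep : ∀ k j : Fin (N + 1), ((N + 1 : ℕ) / M : ℝ) * ‖ω ^ (k : ℕ) - ω ^ (j : ℕ)‖ ≤ ‖v k - v j‖ :=
    fun k j => by
    rw [hωk, hωk]
    exact norm_coord_sub_ge ha haM s j k
  have hprod : ∀ k, ((N + 1 : ℕ) / M : ℝ) ^ N * (N + 1 : ℕ) ≤
      ∏ j ∈ Finset.univ.erase k, ‖v k - v j‖ := fun k => by
    refine le_trans (le_of_eq ?_)
      (Finset.prod_le_prod (fun _ _ => by positivity) fun j _ => hsep k j)
    rw [Finset.prod_mul_distrib, prod_norm_sub_roots_of_unity hω k, Finset.prod_const,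
      Finset.card_erase_of_mem (Finset.mem_univ k), Finset.card_univ, Fintype.card_fin,
      Nat.add_sub_cancel]
  -- Coinciding nodes would make the product in `hprod` vanish.
  have hinj : Set.InjOn v ↑(Finset.univ : Finset (Fin (N + 1))) := by
    intro i _ j _ hij
    by_contra hne
    have h1 := hprod i
    rw [Finset.prod_eq_zero (i := j) (by simpa using Ne.symm hne) (by simp [hij])] at h1
    have : 0 < ((N + 1 : ℕ) / M : ℝ) ^ N * (N + 1 : ℕ) := by positivity
    linarith
  have hK0 : 0 ≤ K := (norm_nonneg _).trans (hK 0)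
  rw [Lagrange.eq_interpolate hinj (f := p) (by simpa using hp), Lagrange.interpolate_apply,
    eval_finsetSum]
  have hterm : ∀ k ∈ Finset.univ, ‖(C (p.eval (v k)) * Lagrange.basis Finset.univ v k).eval z‖ ≤
      K * (2 ^ N / (((N + 1 : ℕ) / M : ℝ) ^ N * (N + 1 : ℕ))) := fun k _ => by
    rw [eval_mul, eval_C, norm_mul]
    refine mul_le_mul (hK k) ?_ (norm_nonneg _) hK0
    rw [Lagrange.basis, eval_prod, norm_prod]
    simp only [Lagrange.basisDivisor, eval_mul, eval_C, eval_sub, eval_X, norm_mul, norm_inv]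
    rw [Finset.prod_mul_distrib, Finset.prod_inv_distrib, inv_mul_eq_div]
    refine div_le_div₀ (by positivity) ?_ (by positivity) (hprod k)
    · refine (Finset.prod_le_prod (fun _ _ => norm_nonneg _)
        (g := fun _ => (2 : ℝ)) fun j _ => ?_).trans ?_
      · refine (norm_sub_le _ _).trans ?_
        rw [hz, norm_coord]
        norm_num
      · rw [Finset.prod_const, Finset.card_erase_of_mem (Finset.mem_univ k), Finset.card_univ,
          Fintype.card_fin, Nat.add_sub_cancel]
  -- The N + 1 summands cancel the factor N + 1 in the denominator.
  refine (norm_sum_le_of_le _ hterm).trans (le_of_eq ?_)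
  rw [Finset.sum_const, Finset.card_univ, Fintype.card_fin, nsmul_eq_mul, div_pow, div_pow, mul_pow]
  field_simp

/-- The number of rotated M-th roots of unity lying in A has mean M m(A) > N over all rotations, so
it is at least N + 1 for some rotation. -/
theorem exists_many_translates {A : Set UnitAddCircle} (hA : MeasurableSet A) {N M : ℕ}
    (h : (N : ℝ) < M * (AddCircle.haarAddCircle : Measure UnitAddCircle).real A) :
    ∃ (s : UnitAddCircle) (a : Fin (N + 1) → ℕ), StrictMono a ∧ (∀ i, a i < M) ∧
      ∀ i, s + ((a i / M : ℝ) : UnitAddCircle) ∈ A := by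
  classical
  let cnt : UnitAddCircle → Finset ℕ := fun s =>
    (Finset.range M).filter fun k : ℕ => s + ((k / M : ℝ) : UnitAddCircle) ∈ A
  suffices h' : ∃ s, N + 1 ≤ (cnt s).card by
    obtain ⟨s, hs⟩ := h'
    have hmem := fun i => Finset.mem_filter.1 (Finset.orderEmbOfCardLe_mem (cnt s) hs i)
    exact ⟨s, Finset.orderEmbOfCardLe (cnt s) hs, OrderEmbedding.strictMono _,
      fun i => Finset.mem_range.1 (hmem i).1, fun i => (hmem i).2⟩
  by_contra! hcon
  have hpre : ∀ k : ℕ, MeasurableSet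
      ((fun s : UnitAddCircle => s + ((k / M : ℝ) : UnitAddCircle)) ⁻¹' A) := fun k =>
    measurable_add_const _ hA
  have hint : ∀ k : ℕ, ∫ s, ((fun s : UnitAddCircle => s + ((k / M : ℝ) : UnitAddCircle)) ⁻¹'
      A).indicator (fun _ => (1 : ℝ)) s ∂(AddCircle.haarAddCircle : Measure UnitAddCircle) =
      (AddCircle.haarAddCircle : Measure UnitAddCircle).real A := fun k => by
    rw [integral_indicator_const _ (hpre k), smul_eq_mul, mul_one, Measure.real,
      measure_preimage_add_right, Measure.real]
  have hsum : ∀ s, ∑ k ∈ Finset.range M,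
      ((fun s : UnitAddCircle => s + ((k / M : ℝ) : UnitAddCircle)) ⁻¹'
        A).indicator (fun _ => (1 : ℝ)) s = ((cnt s).card : ℝ) := fun s => by
    rw [Finset.card_filter]
    push_cast
    exact Finset.sum_congr rfl fun k _ => by simp [Set.indicator_apply]
  have hi : ∀ k ∈ Finset.range M, Integrable
      (((fun s : UnitAddCircle => s + ((k / M : ℝ) : UnitAddCircle)) ⁻¹'
        A).indicator (fun _ => (1 : ℝ))) (AddCircle.haarAddCircle : Measure UnitAddCircle) :=
    fun k _ => (integrable_const (1 : ℝ)).indicator (hpre k)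
  have h1 := integral_finsetSum _ hi
  simp only [hint, Finset.sum_const, Finset.card_range, nsmul_eq_mul] at h1
  have h2 : ∫ s, ∑ k ∈ Finset.range M,
      ((fun s : UnitAddCircle => s + ((k / M : ℝ) : UnitAddCircle)) ⁻¹'
        A).indicator (fun _ => (1 : ℝ)) s ∂(AddCircle.haarAddCircle : Measure UnitAddCircle) ≤
      ∫ _, (N : ℝ) ∂(AddCircle.haarAddCircle : Measure UnitAddCircle) := by
    refine integral_mono (integrable_finsetSum _ hi) (integrable_const _) fun s => ?_
    simp only [hsum]
    exact_mod_cast Nat.lt_succ_iff.1 (hcon s)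
  rw [h1] at h2
  simp at h2
  linarith

/-- A Remez type inequality for polynomials on subsets of the unit circle. -/
theorem remez {A : Set UnitAddCircle} (hA : MeasurableSet A) {γ : ℝ} (hγ : 0 < γ)
    (hAγ : γ ≤ (AddCircle.haarAddCircle : Measure UnitAddCircle).real A) {N : ℕ} {p : ℂ[X]}
    (hp : p.degree < (N + 1 : ℕ)) {K : ℝ} (hK : ∀ t ∈ A, ‖p.eval (coord t)‖ ≤ K)
    (t : UnitAddCircle) : ‖p.eval (coord t)‖ ≤ (4 / γ) ^ N * K := by
  have hγ1 : γ ≤ 1 := hAγ.trans measureReal_le_one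
  -- The least M with Mγ ≥ N + 1 > N; since (N + 1)/γ ≥ 1, it is at most 2(N + 1)/γ, whence the
  -- constant 4/γ.
  let M := ⌈((N + 1 : ℕ) : ℝ) / γ⌉₊
  have hM1 : ((N + 1 : ℕ) : ℝ) / γ ≤ M := Nat.le_ceil _
  have hM2 : (M : ℝ) < ((N + 1 : ℕ) : ℝ) / γ + 1 := Nat.ceil_lt_add_one (by positivity)
  rw [div_le_iff₀ hγ] at hM1
  have hM0 : (0 : ℝ) ≤ M := by positivity
  obtain ⟨s, a, ha, haM, hsA⟩ := exists_many_translates hA (N := N) (M := M) (by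
    have := mul_le_mul_of_nonneg_left hAγ hM0
    push_cast at hM1
    linarith)
  have hK0 : 0 ≤ K := (norm_nonneg _).trans (hK _ (hsA 0))
  refine (norm_eval_le_of_nodes ha haM s hp (fun i => hK _ (hsA i)) (norm_coord t)).trans ?_
  refine mul_le_mul_of_nonneg_right (pow_le_pow_left₀ (by positivity) ?_ _) hK0
  have h1 : (1 : ℝ) ≤ (N + 1 : ℕ) / γ := by
    rw [one_le_div hγ]
    push_cast
    linarith [(Nat.cast_nonneg N : (0 : ℝ) ≤ N)]
  calc (2 * M / (N + 1 : ℕ) : ℝ) ≤ 2 * (2 * ((N + 1 : ℕ) / γ)) / (N + 1 : ℕ) := by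
        gcongr
        linarith
    _ = 4 / γ := by field_simp; norm_num

theorem exists_eval_coord_ne_zero {p : ℂ[X]} (hp : p ≠ 0) : ∃ t, p.eval (coord t) ≠ 0 := by
  by_contra! h
  let n := p.natDegree + 1
  have hω := Complex.isPrimitiveRoot_exp n (Nat.succ_ne_zero _)
  refine hp (Polynomial.eq_zero_of_degree_lt_of_eval_index_eq_zero (s := Finset.range n)
    (v := fun i : ℕ => Complex.exp (2 * Real.pi * Complex.I / n) ^ i) (fun i hi j hj hij => ?_) ?_
    fun i _ => ?_)
  · exact hω.pow_inj (by simpa using hi) (by simpa using hj) hij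
  · rw [Finset.card_range]
    exact degree_le_natDegree.trans_lt (by exact_mod_cast Nat.lt_succ_self _)
  · have := h ((i / n : ℝ) : UnitAddCircle)
    rw [coord_coe] at this
    rw [← Complex.exp_nat_mul, ← this]
    congr 2
    push_cast
    ring

/-! ### Polynomial multiples of a function in H^∞ -/

theorem ae_norm_le_norm (f : LInf) :
    ∀ᵐ t ∂(AddCircle.haarAddCircle : Measure UnitAddCircle), ‖f t‖ ≤ ‖f‖ := by
  have hfin := (Lp.memLp f).eLpNorm_ne_top
  rw [Lp.norm_def]
  rw [eLpNorm_exponent_top] at hfin ⊢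
  filter_upwards [ae_le_eLpNormEssSup (f := (f : UnitAddCircle → ℂ))
    (μ := (AddCircle.haarAddCircle : Measure UnitAddCircle))] with t ht
  rw [← toReal_enorm]
  exact ENNReal.toReal_mono hfin ht

theorem LInf_norm_le_of_ae {f : LInf} {C : ℝ} (hC : 0 ≤ C)
    (h : ∀ᵐ t ∂(AddCircle.haarAddCircle : Measure UnitAddCircle), ‖f t‖ ≤ C) : ‖f‖ ≤ C := by
  simpa using Lp.norm_le_of_ae_bound hC h

theorem integrable_LInf (f : LInf) :
    Integrable f (AddCircle.haarAddCircle : Measure UnitAddCircle) :=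
  (Lp.memLp f).integrable le_top

theorem memLp_eval_mul (p : ℂ[X]) (G : LInf) : MemLp (fun t => p.eval (coord t) * G t) ∞
    (AddCircle.haarAddCircle : Measure UnitAddCircle) :=
  (Lp.memLp G).mul (memLp_of_continuous (continuous_eval_coord p) ∞)

theorem fourierCoeff_monomial_mul (n : ℕ) (c : ℂ) (g : UnitAddCircle → ℂ) (k : ℤ) :
    fourierCoeff (fun t => (monomial n c).eval (coord t) * g t) k = c * fourierCoeff g (k - n) := by
  rw [fourierCoeff, fourierCoeff, ← integral_const_mul]
  refine integral_congr_ae (Eventually.of_forall fun t => ?_)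
  simp only [eval_monomial, fourier_eq_coord_zpow, smul_eq_mul]
  rw [neg_sub, sub_eq_add_neg, zpow_add₀ (coord_ne_zero t), zpow_natCast]
  ring

theorem fourierCoeff_eval_mul (p : ℂ[X]) {G : LInf} (hG : G ∈ HInf) {k : ℤ} (hk : k < 0) :
    fourierCoeff (fun t => p.eval (coord t) * G t) k = 0 := by
  induction p using Polynomial.induction_on' with
  | add p q hp hq =>
    have h := fourierCoeff.add ((memLp_eval_mul p G).integrable le_top)
      ((memLp_eval_mul q G).integrable le_top)
    have h2 : (fun t => (p + q).eval (coord t) * G t) =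
        (fun t => p.eval (coord t) * G t) + fun t => q.eval (coord t) * G t := by
      ext t
      simp [add_mul]
    rw [h2, h, Pi.add_apply, hp, hq, add_zero]
  | monomial n c =>
    rw [fourierCoeff_monomial_mul, hG _ (by omega), mul_zero]

/-- Multiplication of a fixed function in `H^∞` by polynomials. -/
def polyMul (G : HInf) : ℂ[X] →ₗ[ℂ] HInf where
  toFun p := ⟨(memLp_eval_mul p G).toLp _,
    toLp_mem_HInf _ fun _ hk => fourierCoeff_eval_mul p G.2 hk⟩
  map_add' p q := by
    ext1
    exact (MemLp.toLp_congr (memLp_eval_mul (p + q) G)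
      ((memLp_eval_mul p G).add (memLp_eval_mul q G))
      (Eventually.of_forall fun t => by simp [add_mul])).trans
      (MemLp.toLp_add (memLp_eval_mul p G) (memLp_eval_mul q G))
  map_smul' c p := by
    ext1
    exact (MemLp.toLp_congr (memLp_eval_mul (c • p) G) ((memLp_eval_mul p G).const_smul c)
      (Eventually.of_forall fun t => by simp [mul_assoc])).trans
      (MemLp.toLp_const_smul c (memLp_eval_mul p G))

theorem coeFn_polyMul (G : HInf) (p : ℂ[X]) :
    (polyMul G p : LInf) =ᵐ[(AddCircle.haarAddCircle : Measure UnitAddCircle)]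
      fun t => p.eval (coord t) * (G : LInf) t :=
  (memLp_eval_mul p G).coeFn_toLp

/-- N linear conditions on the (N + 1)-dimensional space of coefficients have a nontrivial solution.
-/
theorem exists_polyMul_mem {Φ : Set (StrongDual ℂ HInf)} {N : ℕ} (hΦ : Φ.encard = N) (G : HInf) :
    ∃ p : ℂ[X], p ≠ 0 ∧ p.degree < (N + 1 : ℕ) ∧ polyMul G p ∈ HInfPhi Φ := by
  have hfin : Φ.Finite := Set.finite_of_encard_eq_coe hΦ
  have : Fintype Φ := hfin.fintype
  have hcard : Fintype.card Φ = N := by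
    rw [Set.encard_eq_coe_toFinset_card, Set.toFinset_card] at hΦ
    exact_mod_cast hΦ
  let L : (Fin (N + 1) → ℂ) →ₗ[ℂ] (Φ → ℂ) := LinearMap.pi fun φ =>
    (φ : StrongDual ℂ HInf).toLinearMap ∘ₗ polyMul G ∘ₗ (degreeLT ℂ (N + 1)).subtype ∘ₗ
      (degreeLTEquiv ℂ (N + 1)).symm.toLinearMap
  have hker : LinearMap.ker L ≠ ⊥ := LinearMap.ker_ne_bot_of_finrank_lt (by simp [hcard])
  obtain ⟨x, hx, hx0⟩ := (Submodule.ne_bot_iff _).1 hker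
  refine ⟨(degreeLTEquiv ℂ (N + 1)).symm x, ?_, ?_, fun φ hφ => ?_⟩
  · simpa using hx0
  · exact mem_degreeLT.1 ((degreeLTEquiv ℂ (N + 1)).symm x).2
  · exact congrFun (LinearMap.mem_ker.1 hx) ⟨φ, hφ⟩

theorem exists_normalized_polyMul_mem {Φ : Set (StrongDual ℂ HInf)} {N : ℕ} (hΦ : Φ.encard = N)
    (G : HInf) : ∃ p : ℂ[X], p.degree < (N + 1 : ℕ) ∧ (∀ t, ‖p.eval (coord t)‖ ≤ 1) ∧
      (∃ t, ‖p.eval (coord t)‖ = 1) ∧ polyMul G p ∈ HInfPhi Φ := by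
  obtain ⟨p, hp0, hpd, hpm⟩ := exists_polyMul_mem hΦ G
  obtain ⟨t₀, -, ht₀⟩ := isCompact_univ.exists_isMaxOn Set.univ_nonempty
    (continuous_eval_coord p).norm.continuousOn
  obtain ⟨t₁, ht₁⟩ := exists_eval_coord_ne_zero hp0
  have hm : 0 < ‖p.eval (coord t₀)‖ := (norm_pos_iff.2 ht₁).trans_le (ht₀ (Set.mem_univ t₁))
  have heval : ∀ t, ‖(((‖p.eval (coord t₀)‖ : ℂ)⁻¹ • p).eval (coord t))‖ =
      ‖p.eval (coord t)‖ / ‖p.eval (coord t₀)‖ := fun t => by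
    rw [eval_smul, norm_smul, norm_inv, Complex.norm_real, norm_norm, inv_mul_eq_div]
  refine ⟨(‖p.eval (coord t₀)‖ : ℂ)⁻¹ • p, (degree_smul_le _ _).trans_lt hpd, fun t => ?_,
    ⟨t₀, ?_⟩, ?_⟩
  · rw [heval, div_le_one hm]
    exact ht₀ (Set.mem_univ t)
  · rw [heval, div_self hm.ne']
  · rw [map_smul]
    exact Submodule.smul_mem _ _ hpm

/-! ### The lower bound -/

theorem measurableSet_sublevel (η : ℝ) (f : LInf) : MeasurableSet (sublevel η f) :=
  measurableSet_le (Lp.stronglyMeasurable f).measurable.norm measurable_const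

theorem exists_large_perturbation {Φ : Set (StrongDual ℂ HInf)} {N : ℕ} (hΦ : Φ.encard = N)
    {η γ : ℝ} (hη₁ : η < 1) (hγ₀ : 0 < γ) {f : HInfPhi Φ} (hf : f ∈ classM Φ η γ)
    {δ : ℝ} (hδ : 0 < δ) :
    ∃ g : HInfPhi Φ, ‖f + g‖ ≤ 1 + δ ∧ ‖f - g‖ ≤ 1 + δ ∧ (γ / 4) ^ N * (1 - η) ≤ ‖g‖ := by
  classical
  obtain ⟨hf1, hfm⟩ := hf
  let f₀ : LInf := (f : HInf)
  let E := sublevel η f₀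
  have hE : MeasurableSet E := measurableSet_sublevel η f₀
  -- The modulus exp u uses up the room 1 - η left by f on E, and is δ elsewhere.
  let u : UnitAddCircle → ℝ := fun t => if t ∈ E then Real.log (1 - η) else Real.log δ
  have hu : Measurable u := Measurable.ite hE measurable_const measurable_const
  obtain ⟨G, hGm, hG⟩ := exists_outer hu (C := |Real.log (1 - η)| + |Real.log δ|) fun t => by
    simp only [u]
    split_ifs
    · linarith [abs_nonneg (Real.log δ)]
    · linarith [abs_nonneg (Real.log (1 - η))]
  have hη' : 0 < 1 - η := by linarith
  obtain ⟨p, hpd, hp1, ⟨t₀, ht₀⟩, hpm⟩ := exists_normalized_polyMul_mem hΦ ⟨G, hGm⟩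
  let g : HInfPhi Φ := ⟨_, hpm⟩
  let g₀ : LInf := (g : HInf)
  have hg : g₀ =ᵐ[(AddCircle.haarAddCircle : Measure UnitAddCircle)]
      fun t => p.eval (coord t) * G t := coeFn_polyMul ⟨G, hGm⟩ p
  have hsum : ∀ᵐ t ∂(AddCircle.haarAddCircle : Measure UnitAddCircle),
      ‖f₀ t‖ + ‖g₀ t‖ ≤ 1 + δ := by
    have hfle := ae_norm_le_norm f₀
    filter_upwards [hG, hg, hfle] with t h1 h2 h3
    have h4 : ‖g₀ t‖ ≤ ‖G t‖ := by
      rw [h2, norm_mul]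
      exact mul_le_of_le_one_left (norm_nonneg _) (hp1 t)
    have h5 : ‖f₀‖ = 1 := hf1
    by_cases ht : t ∈ E
    · have h6 : ‖G t‖ = 1 - η := by simp only [h1, u, if_pos ht, Real.exp_log hη']
      have h7 : ‖f₀ t‖ ≤ η := ht
      linarith
    · have h6 : ‖G t‖ = δ := by simp only [h1, u, if_neg ht, Real.exp_log hδ]
      linarith
  refine ⟨g, LInf_norm_le_of_ae (f := f₀ + g₀) (by linarith) ?_,
    LInf_norm_le_of_ae (f := f₀ - g₀) (by linarith) ?_, ?_⟩
  · filter_upwards [hsum, Lp.coeFn_add f₀ g₀] with t h1 h2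
    rw [h2, Pi.add_apply]
    exact (norm_add_le _ _).trans h1
  · filter_upwards [hsum, Lp.coeFn_sub f₀ g₀] with t h1 h2
    rw [h2, Pi.sub_apply]
    exact (norm_sub_le _ _).trans h1
  -- `remez` needs a pointwise bound, while |p| ≤ ‖g₀‖/(1 - η) holds only a.e. on E; A is the
  -- full-measure part of E where it holds.
  · let A : Set UnitAddCircle := {t ∈ E | ‖p.eval (coord t)‖ ≤ ‖g₀‖ / (1 - η)}
    have hA : MeasurableSet A := hE.inter
      (measurableSet_le (continuous_eval_coord p).norm.measurable measurable_const)
    have hAE : A =ᵐ[(AddCircle.haarAddCircle : Measure UnitAddCircle)] E := by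
      filter_upwards [hG, hg, ae_norm_le_norm g₀] with t h1 h2 h3
      refine propext ⟨fun h => h.1, fun ht => ⟨ht, ?_⟩⟩
      have ht' : t ∈ E := ht
      have h6 : ‖G t‖ = 1 - η := by simp only [h1, u, if_pos ht', Real.exp_log hη']
      rw [h2, norm_mul, h6] at h3
      exact (le_div_iff₀ hη').2 h3
    have hrem := remez hA hγ₀ (by rw [measureReal_congr hAE]; exact hfm) hpd (fun t ht => ht.2) t₀
    rw [ht₀] at hrem
    change _ ≤ ‖g₀‖
    calc (γ / 4) ^ N * (1 - η) = (γ / 4) ^ N * (1 - η) * 1 := by ring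
      _ ≤ (γ / 4) ^ N * (1 - η) * ((4 / γ) ^ N * (‖g₀‖ / (1 - η))) := by gcongr
      _ = ((γ / 4) * (4 / γ)) ^ N * ‖g₀‖ * ((1 - η) / (1 - η)) := by rw [mul_pow]; ring
      _ = ‖g₀‖ := by
        rw [div_self hη'.ne', div_mul_div_cancel₀ (by norm_num), div_self hγ₀.ne']; simp

theorem le_epsPhi {Φ : Set (StrongDual ℂ HInf)} {N : ℕ} (hΦ : Φ.encard = N)
    {η γ : ℝ} (hη₁ : η < 1) (hγ₀ : 0 < γ) {f : HInfPhi Φ} (hf : f ∈ classM Φ η γ) :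
    (γ / 4) ^ N * (1 - η) ≤ epsPhi Φ f := by
  -- The number 2 is admissible with δ = 1, since 2‖y‖ ≤ ‖f + y‖ + ‖f - y‖ < 4; the infimum is thus
  -- over a nonempty set.
  refine le_csInf ⟨2, by norm_num, 1, one_pos, fun y hy => ?_⟩ ?_
  · have h1 := (max_lt_iff.1 hy).1
    have h2 := (max_lt_iff.1 hy).2
    let y₀ : LInf := (y : HInf)
    have h3 : ((f + y - (f - y) : HInfPhi Φ) : HInf) = (2 : ℂ) • y₀ := by
      rw [show f + y - (f - y) = y + y by abel, two_smul]
      rfl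
    have h4 : ‖(2 : ℂ) • y₀‖ ≤ ‖f + y‖ + ‖f - y‖ := by
      rw [← h3]
      exact norm_sub_le (f + y) (f - y)
    rw [norm_smul, Complex.norm_ofNat] at h4
    change ‖y₀‖ < 2
    linarith
  · rintro ε ⟨-, δ, hδ, h⟩
    -- Half of δ makes the inequality for f ± g strict.
    obtain ⟨g, h1, h2, h3⟩ := exists_large_perturbation hΦ hη₁ hγ₀ hf (half_pos hδ)
    exact h3.trans (h g (max_lt (by linarith) (by linarith))).le

/-! ### The upper bound -/

/-- With r = max ‖f ± g‖, the parallelogram law gives |f|² + |g|² ≤ r² a.e., so |g|² ≤ r² - η². -/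
theorem epsPhi_le {Φ : Set (StrongDual ℂ HInf)} {η : ℝ} (hη₀ : 0 < η)
    {f : HInfPhi Φ}
    (hf : ∀ᵐ t ∂(AddCircle.haarAddCircle : Measure UnitAddCircle), η ≤ ‖((f : HInf) : LInf) t‖) :
    epsPhi Φ f ≤ Real.sqrt (1 - η ^ 2) := by
  refine le_of_forall_gt_imp_ge_of_dense fun ε hε => csInf_le ⟨0, fun _ h => h.1.le⟩ ?_
  have hε0 : 0 < ε := (Real.sqrt_nonneg _).trans_lt hε
  rw [Real.sqrt_lt' hε0] at hε
  -- Chosen so that (1 + δ)² - η² = ε².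
  refine ⟨hε0, Real.sqrt (ε ^ 2 + η ^ 2) - 1, ?_, fun g hg => ?_⟩
  · rw [sub_pos, Real.lt_sqrt (by norm_num)]
    linarith
  let f₀ : LInf := (f : HInf)
  let g₀ : LInf := (g : HInf)
  set r := max ‖f + g‖ ‖f - g‖ with hr
  have hr0 : 0 ≤ r := (norm_nonneg _).trans (le_max_left _ _)
  rw [add_sub_cancel, Real.lt_sqrt hr0] at hg
  refine (?_ : ‖g₀‖ ≤ Real.sqrt (r ^ 2 - η ^ 2)).trans_lt
    ((Real.sqrt_lt' hε0).2 (by linarith))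
  refine LInf_norm_le_of_ae (Real.sqrt_nonneg _) ?_
  filter_upwards [hf, ae_norm_le_norm (f₀ + g₀), ae_norm_le_norm (f₀ - g₀), Lp.coeFn_add f₀ g₀,
    Lp.coeFn_sub f₀ g₀] with t h1 h2 h3 h4 h5
  have h2' : ‖f₀ t + g₀ t‖ ≤ r := by
    rw [h4] at h2
    exact h2.trans (le_max_left ‖f + g‖ ‖f - g‖)
  have h3' : ‖f₀ t - g₀ t‖ ≤ r := by
    rw [h5] at h3
    exact h3.trans (le_max_right ‖f + g‖ ‖f - g‖)
  have h6 := parallelogram_law_with_norm ℝ (f₀ t) (g₀ t)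
  have h1' : η ≤ ‖f₀ t‖ := h1
  refine Real.le_sqrt_of_sq_le ?_
  nlinarith [norm_nonneg (f₀ t + g₀ t), norm_nonneg (f₀ t - g₀ t)]

/-- The mean value over the circle, as a bounded functional on `H^∞`. -/
def meanValue : StrongDual ℂ HInf :=
  LinearMap.mkContinuous
    { toFun := fun f => ∫ t, (f : LInf) t ∂(AddCircle.haarAddCircle : Measure UnitAddCircle)
      map_add' := fun f g => by
        rw [← integral_add (integrable_LInf f) (integrable_LInf g)]
        exact integral_congr_ae (Lp.coeFn_add (f : LInf) (g : LInf))
      map_smul' := fun c f => by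
        rw [RingHom.id_apply, ← integral_smul]
        exact integral_congr_ae (Lp.coeFn_smul c (f : LInf)) }
    1 fun f => by
      have h := norm_integral_le_of_norm_le_const (ae_norm_le_norm (f : LInf))
      simpa using h

theorem meanValue_apply (f : HInf) : meanValue f =
    ∫ t, (f : LInf) t ∂(AddCircle.haarAddCircle : Measure UnitAddCircle) := rfl

theorem meanValue_ne_zero : meanValue ≠ 0 := by
  intro h
  have hc : MemLp (fun _ : UnitAddCircle => (1 : ℂ)) ∞
    (AddCircle.haarAddCircle : Measure UnitAddCircle) := memLp_const 1
  have h1 : hc.toLp _ ∈ HInf := toLp_mem_HInf hc fun k hk =>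
    fourierCoeff_comp_coord (F := fun _ => 1) (by fun_prop) hk
  have h2 : meanValue ⟨_, h1⟩ = 1 := by
    rw [meanValue_apply, integral_congr_ae hc.coeFn_toLp]
    simp
  rw [h] at h2
  simp at h2

/-- The mean of ζG is the coefficient of G of index -1. -/
theorem meanValue_polyMul_X (G : HInf) : meanValue (polyMul G X) = 0 := by
  rw [meanValue_apply, integral_congr_ae (coeFn_polyMul G X)]
  have h := fourierCoeff_monomial_mul 1 1 (G : LInf) 0
  rw [G.2 _ (by norm_num), mul_zero, fourierCoeff] at h
  rw [← h]
  exact integral_congr_ae (Eventually.of_forall fun t => by simp)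

theorem exists_mem_classM (N : ℕ) {η γ : ℝ} (hη₀ : 0 < η) (hη₁ : η < 1) (hγ₀ : 0 < γ)
    (hγ₁ : γ < 1) :
    ∃ Φ : Set (StrongDual ℂ HInf), Φ.encard = N ∧ ∃ f ∈ classM Φ η γ,
      ∀ᵐ t ∂(AddCircle.haarAddCircle : Measure UnitAddCircle),
        η ≤ ‖((f : HInf) : LInf) t‖ := by
  classical
  -- An arc of length γ on the circle of length 1.
  let A : Set UnitAddCircle := Metric.closedBall 0 (γ / 2)
  have hA : MeasurableSet A := Metric.isClosed_closedBall.measurableSet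
  have hAγ : (AddCircle.haarAddCircle : Measure UnitAddCircle) A = ENNReal.ofReal γ := by
    have h := AddCircle.volume_closedBall 1 (x := 0) (γ / 2)
    rw [AddCircle.volume_eq_smul_haarAddCircle, ENNReal.ofReal_one, one_smul] at h
    rw [h, mul_div_cancel₀ _ (by norm_num), min_eq_right hγ₁.le]
  let u : UnitAddCircle → ℝ := fun t => if t ∈ A then Real.log η else 0
  have hu : Measurable u := Measurable.ite hA measurable_const measurable_const
  obtain ⟨G, hGm, hG⟩ := exists_outer hu (C := |Real.log η|) fun t => by
    simp only [u]
    split_ifs <;> simp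
  -- Exactly N functionals are required; distinct nonzero multiples of one functional impose a
  -- single condition.
  let Φ : Set (StrongDual ℂ HInf) := Set.range fun k : Fin N => ((k : ℕ) + 1 : ℂ) • meanValue
  have hinj : Function.Injective fun k : Fin N => ((k : ℕ) + 1 : ℂ) • meanValue := by
    intro i j hij
    have h := smul_left_injective ℂ meanValue_ne_zero hij
    exact Fin.ext (by exact_mod_cast add_right_cancel h)
  have hΦ : Φ.encard = N := by
    have : Φ = (fun k : Fin N => ((k : ℕ) + 1 : ℂ) • meanValue) '' Set.univ :=
      Set.image_univ.symm
    rw [this, hinj.encard_image]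
    simp
  have hmem : polyMul ⟨G, hGm⟩ X ∈ HInfPhi Φ := by
    rintro _ ⟨k, rfl⟩
    rw [smul_apply, meanValue_polyMul_X, smul_zero]
  let f : HInfPhi Φ := ⟨_, hmem⟩
  let f₀ : LInf := (f : HInf)
  have hf : ∀ᵐ t ∂(AddCircle.haarAddCircle : Measure UnitAddCircle),
      ‖f₀ t‖ = if t ∈ A then η else 1 := by
    filter_upwards [hG, coeFn_polyMul ⟨G, hGm⟩ X] with t h1 h2
    change ‖(polyMul ⟨G, hGm⟩ X : LInf) t‖ = _
    rw [h2, norm_mul, eval_X, norm_coord, one_mul, h1]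
    simp only [u]
    split_ifs
    · exact Real.exp_log hη₀
    · exact Real.exp_zero
  refine ⟨Φ, hΦ, f, ⟨le_antisymm ?_ ?_, ?_⟩, ?_⟩
  · refine LInf_norm_le_of_ae (f := f₀) zero_le_one ?_
    filter_upwards [hf] with t ht
    rw [ht]
    split_ifs
    · exact hη₁.le
    · exact le_rfl
  -- Off A the modulus is 1, so a norm below 1 would give A full measure, contrary to γ < 1.
  · by_contra! hlt
    have hlt' : ‖f₀‖ < 1 := hlt
    have hall : ∀ᵐ t ∂(AddCircle.haarAddCircle : Measure UnitAddCircle), t ∈ A := by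
      filter_upwards [hf, ae_norm_le_norm f₀] with t h1 h2
      by_contra ht
      rw [if_neg ht] at h1
      linarith
    have h1 : (AddCircle.haarAddCircle : Measure UnitAddCircle) A = 1 :=
      (prob_compl_eq_zero_iff hA).1 hall
    rw [hAγ, ENNReal.ofReal_eq_one] at h1
    linarith
  · have h1 : (AddCircle.haarAddCircle : Measure UnitAddCircle).real A = γ := by
      rw [Measure.real, hAγ, ENNReal.toReal_ofReal hγ₀.le]
    rw [← h1]
    refine ENNReal.toReal_mono (measure_ne_top _ _) (measure_mono_ae ?_)
    filter_upwards [hf] with t ht htA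
    have htA' : t ∈ A := htA
    rw [if_pos htA'] at ht
    exact ht.le
  · filter_upwards [hf] with t ht
    change η ≤ ‖f₀ t‖
    rw [ht]
    split_ifs
    · exact le_rfl
    · exact hη₁.le

end HardyExtreme

end

theorem theorem2 (N : ℕ) (hN : 0 < N) (η γ : ℝ) (hη₀ : 0 < η) (hη₁ : η < 1)
    (hγ₀ : 0 < γ) (hγ₁ : γ < 1) :
    (Real.pi / (16 * Real.exp 1) * γ) ^ N * (1 - η) ≤ HardyExtreme.epsStar N η γ ∧
      HardyExtreme.epsStar N η γ ≤ Real.sqrt (1 - η ^ 2) := by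
  have hlow : ∀ e ∈ HardyExtreme.epsValues N η γ, (γ / 4) ^ N * (1 - η) ≤ e := by
    rintro e ⟨Φ, hΦ, f, hf, rfl⟩
    exact HardyExtreme.le_epsPhi hΦ hη₁ hγ₀ hf
  obtain ⟨Φ, hΦ, f, hf, hfη⟩ := HardyExtreme.exists_mem_classM N hη₀ hη₁ hγ₀ hγ₁
  have hmem : HardyExtreme.epsPhi Φ f ∈ HardyExtreme.epsValues N η γ := ⟨Φ, hΦ, f, hf, rfl⟩
  refine ⟨?_, (csInf_le ⟨_, hlow⟩ hmem).trans (HardyExtreme.epsPhi_le hη₀ hfη)⟩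
  refine le_trans ?_ (le_csInf ⟨_, hmem⟩ hlow)
  -- This is π ≤ 4 ≤ 4e.
  have h1 : Real.pi / (16 * Real.exp 1) ≤ 1 / 4 := by
    rw [div_le_iff₀ (by positivity)]
    linarith [Real.pi_le_four, Real.add_one_le_exp (1 : ℝ)]
  have h2 : Real.pi / (16 * Real.exp 1) * γ ≤ γ / 4 := by
    calc _ ≤ 1 / 4 * γ := by gcongr
      _ = γ / 4 := by ring
  exact mul_le_mul_of_nonneg_right (pow_le_pow_left₀ (by positivity) h2 N) (by linarith)
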